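/- **Optimal state-dependent cloning fidelity.** Let $\phi\in[0,\pi/4)$ and let $|a\rangle=\cos\phi\,|0\rangle+\sin\phi\,|1\rangle$, $|b\rangle=\sin\phi\,|0\rangle+\cos\phi\,|1\rangle$ be qubit states, so that $\langle a|b\rangle=\sin 2\phi$; write $|aa\rangle=|a\rangle\otimes|a\rangle$, $|bb\rangle=|b\rangle\otimes|b\rangle$, $|a0\rangle=|a\rangle\otimes|0\rangle$, $|b0\rangle=|b\rangle\otimes|0\rangle$. Put $$\widetilde\Omega=2\arccos(\sin 2\phi)-2\arccos(\sin^2 2\phi).$$ Then: 1. $\widetilde\Omega\le 0$. 2. For all priors $\pi_1,\pi_2\ge 0$ with $\pi_1+\pi_2=1$, set $$\mathcal F(\pi_1,\pi_2)=\tfrac12+\tfrac12\sqrt{\pi_1^2+\pi_2^2+2\pi_1\pi_2\cos\widetilde\Omega}.$$ - (a) $\mathcal F(\pi_1,\pi_2)$ is the maximum of the global fidelity $\pi_1|\langle aa|U|a0\rangle|^2+\pi_2|\langle bb|U|b0\rangle|^2$ over all unitaries $U$ on $\mathbb C^2\otimes\mathbb C^2$. - (b) $\mathcal F(\pi_1,\pi_2)$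 is also the maximum of $\pi_1\operatorname{Tr}[\mathcal C(|a\rangle\langle a|)\,|aa\rangle\langle aa|]+\pi_2\operatorname{Tr}[\mathcal C(|b\rangle\langle b|)\,|bb\rangle\langle bb|]$ over all quantum operations (completely positive trace-preserving maps) $\mathcal C$ from one qubit to two qubits. - (c) For any unit vectors $s_1,s_2,t_1,t_2\in\mathbb C^2$ with $\langle s_1|s_2\rangle=\sin 2\phi$ and $\langle t_1|t_2\rangle=\sin^2 2\phi$ (the overlaps of $|a0\rangle,|b0\rangle$ and of $|aa\rangle,|bb\rangle$), $\mathcal F(\pi_1,\pi_2)$ is the maximum of $\pi_1\operatorname{Tr}[\mathcal C(|s_1\rangle\langle s_1|)\,|t_1\rangle\langle t_1|]+\pi_2\operatorname{Tr}[\mathcal C(|s_2\rangle\langle s_2|)\,|t_2\rangle\langle t_2|]$ over all qubit quantum operations $\mathcal C$. 3. For equal priors this is the optimum of Bruß et al.: $$\mathcal F(\tfrac12,\tfrac12)=\tfrac14\Big(\sqrt{1+\sin^2 2\phi}\,\sqrt{1+\sin 2\phi}+\cos 2\phi\,\sqrt{1-\sin 2\phi}\Big)^2,$$ and this number is the maximum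 over unitaries $U$ on $\mathbb C^2\otimes\mathbb C^2$ of $\tfrac12\big(|\langle aa|U|a0\rangle|^2+|\langle bb|U|b0\rangle|^2\big)$. -/

import Mathlib

namespace Cloning

open scoped ComplexOrder

/-- The squared modulus `|⟨u|v⟩|²` of the standard inner product (conjugate-linear in `u`). -/
noncomputable def overlapSq {ι : Type*} [Fintype ι] (u v : ι → ℂ) : ℝ :=
  ‖star u ⬝ᵥ v‖ ^ 2

/-- The product vector `|u⟩ ⊗ |v⟩`. -/
def tensor {ι κ : Type*} (u : ι → ℂ) (v : κ → ℂ) : ι × κ → ℂ :=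
  fun p => u p.1 * v p.2

/-- The blank state `|0⟩` of a qubit. -/
def ket0 : Fin 2 → ℂ := ![1, 0]

/-- `|a⟩ = cos φ |0⟩ + sin φ |1⟩`. -/
noncomputable def ketA (φ : ℝ) : Fin 2 → ℂ := ![(Real.cos φ : ℂ), (Real.sin φ : ℂ)]

/-- `|b⟩ = sin φ |0⟩ + cos φ |1⟩`. -/
noncomputable def ketB (φ : ℝ) : Fin 2 → ℂ := ![(Real.sin φ : ℂ), (Real.cos φ : ℂ)]

/-- The global fidelity `π₁ |⟨aa|U|a0⟩|² + π₂ |⟨bb|U|b0⟩|²` of a two-qubit cloning unitary `U`. -/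
noncomputable def globalFidelity (π₁ π₂ φ : ℝ)
    (U : Matrix.unitaryGroup (Fin 2 × Fin 2) ℂ) : ℝ :=
  π₁ * overlapSq (tensor (ketA φ) (ketA φ))
      ((U : Matrix (Fin 2 × Fin 2) (Fin 2 × Fin 2) ℂ).mulVec (tensor (ketA φ) ket0)) +
  π₂ * overlapSq (tensor (ketB φ) (ketB φ))
      ((U : Matrix (Fin 2 × Fin 2) (Fin 2 × Fin 2) ℂ).mulVec (tensor (ketB φ) ket0))

/-- The trace of an element of the C⋆-algebra of `ι × ι` complex matrices. -/
noncomputable def tr {ι : Type*} [Fintype ι] (X : CStarMatrix ι ι ℂ) : ℂ :=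
  Matrix.trace (CStarMatrix.ofMatrix.symm X)

/-- The rank-one operator `|v⟩⟨v|`. -/
noncomputable def pureState {ι : Type*} (v : ι → ℂ) : CStarMatrix ι ι ℂ :=
  CStarMatrix.ofMatrix (Matrix.vecMulVec v (star v))

/-- Quantum operations: completely positive trace-preserving maps from operators on `ℂ^ι` to
operators on `ℂ^κ`. -/
structure QuantumOperation (ι κ : Type) [Fintype ι] [DecidableEq ι] [Fintype κ]
    [DecidableEq κ] where
  /-- The underlying completely positive map. -/
  toCP : CompletelyPositiveMap (CStarMatrix ι ι ℂ) (CStarMatrix κ κ ℂ)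
  /-- The map preserves the trace. -/
  tr_map : ∀ X : CStarMatrix ι ι ℂ, tr (toCP X) = tr X

/-- The average fidelity `π₁ Tr[C(|s₁⟩⟨s₁|) |t₁⟩⟨t₁|] + π₂ Tr[C(|s₂⟩⟨s₂|) |t₂⟩⟨t₂|]` of a quantum
operation `C` for transforming the pure states `s₁, s₂` into the pure states `t₁, t₂`. Both traces
are real, as traces of products of two positive semidefinite matrices. -/
noncomputable def trackingFidelity {ι κ : Type} [Fintype ι] [DecidableEq ι] [Fintype κ]
    [DecidableEq κ] (π₁ π₂ : ℝ) (s₁ s₂ : ι → ℂ) (t₁ t₂ : κ → ℂ) (C : QuantumOperation ι κ) : ℝ :=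
  π₁ * (tr (C.toCP (pureState s₁) * pureState t₁)).re +
  π₂ * (tr (C.toCP (pureState s₂) * pureState t₂)).re

/-- `Ω̃ = 2 arccos (sin 2φ) - 2 arccos (sin² 2φ)`. -/
noncomputable def indicator (φ : ℝ) : ℝ :=
  2 * Real.arccos (Real.sin (2 * φ)) - 2 * Real.arccos (Real.sin (2 * φ) ^ 2)

/-- `1/2 + 1/2 √(π₁² + π₂² + 2 π₁ π₂ cos Ω̃)`. -/
noncomputable def optimalFidelity (π₁ π₂ φ : ℝ) : ℝ :=
  1 / 2 + 1 / 2 * Real.sqrt (π₁ ^ 2 + π₂ ^ 2 + 2 * π₁ * π₂ * Real.cos (indicator φ))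

/-- The optimal global fidelity of the state-dependent cloner of Bruß, DiVincenzo, Ekert, Fuchs,
Macchiavello and Smolin (equal priors). -/
noncomputable def brussFidelity (φ : ℝ) : ℝ :=
  1 / 4 * (Real.sqrt (1 + Real.sin (2 * φ) ^ 2) * Real.sqrt (1 + Real.sin (2 * φ)) +
    Real.cos (2 * φ) * Real.sqrt (1 - Real.sin (2 * φ))) ^ 2

end Cloning

/-!
Let `c = ⟨s₁|s₂⟩` and `t = ⟨t₁|t₂⟩` be the overlaps of the sources and of the targets, `0 ≤ t ≤ c`.

*Upper bound for unitaries.* A unitary keeps the Fubini–Study angle `arccos c` between the sources.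
By the triangle inequality, the angles `x` and `y` of the two outputs to their targets satisfy
`x + y ≥ arccos t - arccos c`. As `cos² x = (1 + cos 2x) / 2`, it remains to maximise
`p cos 2x + q cos 2y` under this constraint. With `T = 2 arccos t - 2 arccos c`, the maximum is the
length of the planar vector `p + q exp (i T)`.

*Attainment.* Two vectors at angle `arccos c` in the real plane of `t₁` and `t₂`, suitably rotated,
give equality. They have the Gram matrix of the sources, so some unitary maps the sources to them.

*Quantum operations.* A quantum operation is an isometry followed by the loss of an environment, and
its fidelity with a pure target `tᵢ` is the squared overlap of the isometry's output with `eᵢ ⊗ tᵢ`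
for an optimal environment state `eᵢ`. Tensoring with `e₁` and `e₂` only lowers the overlap of the
targets, so the bound for unitaries persists.
-/

namespace Cloning

open scoped ComplexOrder Matrix

lemma mul_cos_add_mul_cos_le {p q x y T : ℝ} (hp : 0 ≤ p) (hq : 0 ≤ q)
    (hx : x ∈ Set.Icc 0 Real.pi) (hy : y ∈ Set.Icc 0 Real.pi) (hT : 0 ≤ T) (h : T ≤ x + y) :
    p * Real.cos x + q * Real.cos y ≤ √(p ^ 2 + q ^ 2 + 2 * p * q * Real.cos T) := by
  obtain ⟨x', y', hx', hy', hxx, hyy, rfl⟩ :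
      ∃ x' y', 0 ≤ x' ∧ 0 ≤ y' ∧ x' ≤ x ∧ y' ≤ y ∧ T = x' + y' := by
    rcases le_total x T with hxT | hxT
    · exact ⟨x, T - x, hx.1, by linarith, le_rfl, by linarith, by ring⟩
    · exact ⟨T, 0, hT, le_rfl, hxT, hy.1, by ring⟩
  calc p * Real.cos x + q * Real.cos y
      ≤ p * Real.cos x' + q * Real.cos y' := by
        gcongr
        · exact Real.cos_le_cos_of_nonneg_of_le_pi hx' hx.2 hxx
        · exact Real.cos_le_cos_of_nonneg_of_le_pi hy' hy.2 hyy
    _ ≤ √(p ^ 2 + q ^ 2 + 2 * p * q * Real.cos (x' + y')) := by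
      apply Real.le_sqrt_of_sq_le
      rw [Real.cos_add]
      -- the two sides differ by `(p sin x' - q sin y')²`
      linear_combination sq_nonneg (p * Real.sin x' - q * Real.sin y') +
        p ^ 2 * Real.sin_sq_add_cos_sq x' + q ^ 2 * Real.sin_sq_add_cos_sq y'

lemma exists_mul_cos_add_mul_cos_eq (p q T : ℝ) :
    ∃ x, p * Real.cos x + q * Real.cos (T - x) =
      √(p ^ 2 + q ^ 2 + 2 * p * q * Real.cos T) := by
  let z : ℂ := ⟨p + q * Real.cos T, q * Real.sin T⟩
  have hnorm : ‖z‖ = √(p ^ 2 + q ^ 2 + 2 * p * q * Real.cos T) := by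
    rw [Complex.norm_def, Complex.normSq_mk]
    congr 1
    linear_combination q ^ 2 * Real.sin_sq_add_cos_sq T
  have hre : ‖z‖ * Real.cos z.arg = p + q * Real.cos T := Complex.norm_mul_cos_arg z
  have him : ‖z‖ * Real.sin z.arg = q * Real.sin T := Complex.norm_mul_sin_arg z
  refine ⟨z.arg, ?_⟩
  rw [← hnorm, Real.cos_sub]
  linear_combination (-Real.cos z.arg) * hre - Real.sin z.arg * him +
    ‖z‖ * Real.sin_sq_add_cos_sq z.arg

/-- The optimal average fidelity, with weights `p` and `q`, for transforming two pure states of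
overlap `c` into two pure states of overlap `t`. -/
noncomputable def trackingOptimum (p q c t : ℝ) : ℝ :=
  1 / 2 + 1 / 2 * √(p ^ 2 + q ^ 2 +
    2 * p * q * Real.cos (2 * Real.arccos c - 2 * Real.arccos t))

lemma trackingOptimum_half {c t : ℝ} (hc₀ : 0 ≤ c) (hc₁ : c ≤ 1) (ht₀ : 0 ≤ t) (ht₁ : t ≤ 1) :
    trackingOptimum (1 / 2) (1 / 2) c t =
      1 / 2 + 1 / 2 * (c * t + √(1 - c ^ 2) * √(1 - t ^ 2)) := by
  have hcos : Real.cos (Real.arccos c - Real.arccos t) =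
      c * t + √(1 - c ^ 2) * √(1 - t ^ 2) := by
    rw [Real.cos_sub, Real.cos_arccos (by linarith) hc₁, Real.cos_arccos (by linarith) ht₁,
      Real.sin_arccos, Real.sin_arccos]
  have hsq : (1 / 2 : ℝ) ^ 2 + (1 / 2) ^ 2 +
      2 * (1 / 2) * (1 / 2) * Real.cos (2 * Real.arccos c - 2 * Real.arccos t) =
        (c * t + √(1 - c ^ 2) * √(1 - t ^ 2)) ^ 2 := by
    rw [← mul_sub, Real.cos_two_mul, hcos]
    ring
  rw [trackingOptimum, hsq, Real.sqrt_sq (by positivity)]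

section FubiniStudy

variable {𝕜 E : Type*} [RCLike 𝕜] [NormedAddCommGroup E] [InnerProductSpace 𝕜 E] {u v x y : E}

variable (𝕜) in
/-- The Fubini–Study distance between the rays through `x` and `y`. Nothing is normalised: the
value is meaningful for unit vectors. -/
noncomputable def fubiniStudyAngle (x y : E) : ℝ :=
  Real.arccos ‖inner 𝕜 x y‖

lemma fubiniStudyAngle_comm (x y : E) : fubiniStudyAngle 𝕜 x y = fubiniStudyAngle 𝕜 y x := by
  rw [fubiniStudyAngle, fubiniStudyAngle, norm_inner_symm]

lemma exists_re_inner_smul_eq_norm (x y : E) :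
    ∃ k : 𝕜, ‖k‖ = 1 ∧ RCLike.re (inner 𝕜 x (k • y)) = ‖inner 𝕜 x y‖ := by
  obtain ⟨k, hk, hk'⟩ := RCLike.exists_norm_eq_mul_self (inner 𝕜 x y)
  exact ⟨k, hk, by rw [inner_smul_right, ← hk', RCLike.ofReal_re]⟩

lemma arccos_re_inner_le_add (hx : ‖x‖ = 1) (hy : ‖y‖ = 1) {z : E} (hz : ‖z‖ = 1) :
    Real.arccos (RCLike.re (inner 𝕜 x z)) ≤
      Real.arccos (RCLike.re (inner 𝕜 x y)) + Real.arccos (RCLike.re (inner 𝕜 y z)) := by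
  let _ := InnerProductSpace.rclikeToReal 𝕜 E
  simpa only [InnerProductGeometry.angle, real_inner_eq_re_inner 𝕜, hx, hy, hz, mul_one, div_one]
    using InnerProductGeometry.angle_le_angle_add_angle x y z

lemma fubiniStudyAngle_le_add (hx : ‖x‖ = 1) (hy : ‖y‖ = 1) {z : E} (hz : ‖z‖ = 1) :
    fubiniStudyAngle 𝕜 x z ≤ fubiniStudyAngle 𝕜 x y + fubiniStudyAngle 𝕜 y z := by
  obtain ⟨k, hk, hxy⟩ := exists_re_inner_smul_eq_norm (𝕜 := 𝕜) y x
  obtain ⟨l, hl, hyz⟩ := exists_re_inner_smul_eq_norm (𝕜 := 𝕜) y z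
  have hnorm : ‖inner 𝕜 (k • x) (l • z)‖ = ‖inner 𝕜 x z‖ := by
    simp only [inner_smul_left, inner_smul_right, norm_mul, RCLike.norm_conj, hk, hl, one_mul]
  have htri := arccos_re_inner_le_add (𝕜 := 𝕜) (x := k • x) (z := l • z)
    (by rw [norm_smul, hk, hx, one_mul]) hy (by rw [norm_smul, hl, hz, one_mul])
  rw [inner_re_symm (k • x) y, hxy, hyz, norm_inner_symm] at htri
  calc fubiniStudyAngle 𝕜 x z
      ≤ Real.arccos (RCLike.re (inner 𝕜 (k • x) (l • z))) :=
        Real.arccos_le_arccos ((RCLike.re_le_norm _).trans_eq hnorm)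
    _ ≤ fubiniStudyAngle 𝕜 x y + fubiniStudyAngle 𝕜 y z := htri

lemma two_mul_fubiniStudyAngle_mem_Icc (x y : E) :
    2 * fubiniStudyAngle 𝕜 x y ∈ Set.Icc 0 Real.pi := by
  have hle : fubiniStudyAngle 𝕜 x y ≤ Real.pi / 2 :=
    Real.arccos_le_pi_div_two.2 (norm_nonneg _)
  have hnonneg : 0 ≤ fubiniStudyAngle 𝕜 x y := Real.arccos_nonneg _
  constructor <;> linarith

lemma norm_inner_sq_eq (hx : ‖x‖ = 1) (hy : ‖y‖ = 1) :
    ‖inner 𝕜 x y‖ ^ 2 = 1 / 2 + Real.cos (2 * fubiniStudyAngle 𝕜 x y) / 2 := by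
  have hle : ‖inner 𝕜 x y‖ ≤ 1 := by simpa [hx, hy] using norm_inner_le_norm (𝕜 := 𝕜) x y
  rw [← Real.cos_sq, fubiniStudyAngle,
    Real.cos_arccos (by linarith [norm_nonneg (inner 𝕜 x y)]) hle]

lemma mul_norm_inner_sq_add_le_trackingOptimum {p q c t : ℝ} (hp : 0 ≤ p) (hq : 0 ≤ q)
    (hpq : p + q = 1) (htc : t ≤ c) (hx : ‖x‖ = 1) (hy : ‖y‖ = 1) (hu : ‖u‖ = 1) (hv : ‖v‖ = 1)
    (hxy : c ≤ ‖inner 𝕜 x y‖) (huv : ‖inner 𝕜 u v‖ ≤ t) :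
    p * ‖inner 𝕜 u x‖ ^ 2 + q * ‖inner 𝕜 v y‖ ^ 2 ≤ trackingOptimum p q c t := by
  have hangle : Real.arccos t - Real.arccos c ≤
      fubiniStudyAngle 𝕜 u x + fubiniStudyAngle 𝕜 v y := by
    have huv' : Real.arccos t ≤ fubiniStudyAngle 𝕜 u v := Real.arccos_le_arccos huv
    have hxy' : fubiniStudyAngle 𝕜 x y ≤ Real.arccos c := Real.arccos_le_arccos hxy
    have huxv := fubiniStudyAngle_le_add (𝕜 := 𝕜) hu hx hv
    have hxyv := fubiniStudyAngle_le_add (𝕜 := 𝕜) hx hy hv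
    rw [fubiniStudyAngle_comm y v] at hxyv
    linarith
  have hcos := mul_cos_add_mul_cos_le hp hq (two_mul_fubiniStudyAngle_mem_Icc (𝕜 := 𝕜) u x)
    (two_mul_fubiniStudyAngle_mem_Icc (𝕜 := 𝕜) v y)
    (T := 2 * Real.arccos t - 2 * Real.arccos c)
    (by linarith [Real.arccos_le_arccos htc]) (by linarith)
  rw [norm_inner_sq_eq hu hx, norm_inner_sq_eq hv hy, trackingOptimum,
    ← neg_sub (2 * Real.arccos t), Real.cos_neg]
  linear_combination (1 / 2) * hcos + (1 / 2) * hpq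

end FubiniStudy

section Slerp

variable {ι : Type*} {θ : ℝ}

/-- Spherical linear interpolation: the vector at angle `γ` from `u` on the arc towards a vector
`v` at angle `θ` from `u`. It requires `sin θ ≠ 0`. -/
noncomputable def slerp (u v : ι → ℂ) (θ γ : ℝ) : ι → ℂ :=
  ((Real.sin (θ - γ) / Real.sin θ : ℝ) : ℂ) • u + ((Real.sin γ / Real.sin θ : ℝ) : ℂ) • v

lemma slerp_zero (hθ : Real.sin θ ≠ 0) (u v : ι → ℂ) : slerp u v θ 0 = u := by
  simp only [slerp, sub_zero, div_self hθ, Complex.ofReal_one, one_smul, Real.sin_zero, zero_div,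
    Complex.ofReal_zero, zero_smul, add_zero]

lemma slerp_self (hθ : Real.sin θ ≠ 0) (u v : ι → ℂ) : slerp u v θ θ = v := by
  simp only [slerp, sub_self, Real.sin_zero, zero_div, Complex.ofReal_zero, zero_smul,
    div_self hθ, Complex.ofReal_one, one_smul, zero_add]

end Slerp

section UnitPair

variable {ι κ : Type*} [Fintype ι] [Fintype κ] {u v x y : ι → ℂ} {c t : ℝ}

lemma inner_toLp_toLp (u v : ι → ℂ) :
    inner ℂ (WithLp.toLp 2 u) (WithLp.toLp 2 v) = star u ⬝ᵥ v := by
  rw [EuclideanSpace.inner_toLp_toLp, dotProduct_comm]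

lemma norm_toLp_eq_one (hu : star u ⬝ᵥ u = 1) : ‖WithLp.toLp 2 u‖ = 1 := by
  rw [norm_eq_sqrt_re_inner (𝕜 := ℂ), inner_toLp_toLp, hu, RCLike.one_re, Real.sqrt_one]

lemma norm_star_dotProduct_le_one (hu : star u ⬝ᵥ u = 1) (hv : star v ⬝ᵥ v = 1) :
    ‖star u ⬝ᵥ v‖ ≤ 1 := by
  simpa only [inner_toLp_toLp, norm_toLp_eq_one hu, norm_toLp_eq_one hv, mul_one] using
    norm_inner_le_norm (𝕜 := ℂ) (WithLp.toLp 2 u) (WithLp.toLp 2 v)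

lemma mul_overlapSq_add_le_trackingOptimum {p q : ℝ} (hp : 0 ≤ p) (hq : 0 ≤ q)
    (hpq : p + q = 1) (htc : t ≤ c) (hx : star x ⬝ᵥ x = 1) (hy : star y ⬝ᵥ y = 1)
    (hu : star u ⬝ᵥ u = 1) (hv : star v ⬝ᵥ v = 1) (hxy : c ≤ ‖star x ⬝ᵥ y‖)
    (huv : ‖star u ⬝ᵥ v‖ ≤ t) :
    p * overlapSq u x + q * overlapSq v y ≤ trackingOptimum p q c t := by
  simp only [overlapSq, ← inner_toLp_toLp] at hxy huv ⊢
  exact mul_norm_inner_sq_add_le_trackingOptimum hp hq hpq htc (norm_toLp_eq_one hx)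
    (norm_toLp_eq_one hy) (norm_toLp_eq_one hu) (norm_toLp_eq_one hv) hxy huv

/-- Two unit vectors `u` and `v` whose overlap `⟨u|v⟩` is the real number `c`. -/
structure UnitPair (u v : ι → ℂ) (c : ℝ) : Prop where
  left : star u ⬝ᵥ u = 1
  right : star v ⬝ᵥ v = 1
  overlap : star u ⬝ᵥ v = (c : ℂ)

lemma star_tensor_dotProduct_tensor (u x : ι → ℂ) (v y : κ → ℂ) :
    star (tensor u v) ⬝ᵥ tensor x y = (star u ⬝ᵥ x) * (star v ⬝ᵥ y) := by
  simp only [dotProduct, tensor, Fintype.sum_prod_type, Finset.sum_mul_sum, Pi.star_apply,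
    star_mul', mul_mul_mul_comm]

lemma star_mulVec_dotProduct_mulVec [DecidableEq ι] {W : Matrix κ ι ℂ} (hW : Wᴴ * W = 1)
    (u v : ι → ℂ) : star (W *ᵥ u) ⬝ᵥ (W *ᵥ v) = star u ⬝ᵥ v := by
  rw [Matrix.star_mulVec, Matrix.dotProduct_mulVec, Matrix.vecMul_vecMul, hW, Matrix.vecMul_one]

namespace UnitPair

lemma abs_le_one (h : UnitPair u v c) : |c| ≤ 1 := by
  simpa only [h.overlap, Complex.norm_real, Real.norm_eq_abs] using
    norm_star_dotProduct_le_one h.left h.right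

lemma overlap_symm (h : UnitPair u v c) : star v ⬝ᵥ u = (c : ℂ) := by
  rw [← star_star (star v ⬝ᵥ u), Matrix.star_dotProduct, star_star, h.overlap]
  exact Complex.conj_ofReal c

lemma norm_overlap (h : UnitPair u v c) : ‖star u ⬝ᵥ v‖ = |c| := by
  rw [h.overlap, Complex.norm_real, Real.norm_eq_abs]

lemma mulVec [DecidableEq ι] {W : Matrix κ ι ℂ} (hW : Wᴴ * W = 1) (h : UnitPair u v c) :
    UnitPair (W *ᵥ u) (W *ᵥ v) c where
  left := by rw [star_mulVec_dotProduct_mulVec hW, h.left]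
  right := by rw [star_mulVec_dotProduct_mulVec hW, h.right]
  overlap := by rw [star_mulVec_dotProduct_mulVec hW, h.overlap]

lemma tensor {w z : κ → ℂ} {d : ℝ} (h : UnitPair u v c) (h' : UnitPair w z d) :
    UnitPair (tensor u w) (tensor v z) (c * d) where
  left := by rw [star_tensor_dotProduct_tensor, h.left, h'.left, one_mul]
  right := by rw [star_tensor_dotProduct_tensor, h.right, h'.right, one_mul]
  overlap := by rw [star_tensor_dotProduct_tensor, h.overlap, h'.overlap, Complex.ofReal_mul]

end UnitPair

lemma UnitPair.star_slerp_dotProduct_slerp {θ : ℝ} (h : UnitPair u v (Real.cos θ))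
    (hθ : Real.sin θ ≠ 0) (γ δ : ℝ) :
    star (slerp u v θ γ) ⬝ᵥ slerp u v θ δ = ((Real.cos (γ - δ) : ℝ) : ℂ) := by
  have hgram (a b a' b' : ℝ) : star ((a : ℂ) • u + (b : ℂ) • v) ⬝ᵥ ((a' : ℂ) • u + (b' : ℂ) • v) =
      ((a * a' + b * b' + (a * b' + b * a') * Real.cos θ : ℝ) : ℂ) := by
    simp only [star_add, star_smul, add_dotProduct, dotProduct_add, smul_dotProduct,
      dotProduct_smul, h.left, h.right, h.overlap, h.overlap_symm, smul_eq_mul, RCLike.star_def,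
      Complex.conj_ofReal]
    push_cast
    ring
  rw [slerp, slerp, hgram, Real.sin_sub, Real.sin_sub, Real.cos_sub]
  congr 1
  field_simp
  linear_combination (-Real.sin γ * Real.sin δ) * Real.sin_sq_add_cos_sq θ

lemma UnitPair.exists_optimal (h : UnitPair u v t) (ht : |t| < 1) (hc : |c| ≤ 1) {p q : ℝ}
    (hpq : p + q = 1) :
    ∃ x y, UnitPair x y c ∧ p * overlapSq u x + q * overlapSq v y = trackingOptimum p q c t := by
  obtain ⟨ht₁, ht₂⟩ := abs_lt.1 ht
  obtain ⟨hc₁, hc₂⟩ := abs_le.1 hc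
  let θ := Real.arccos t
  have hcosθ : Real.cos θ = t := Real.cos_arccos ht₁.le ht₂.le
  have hsinθ : Real.sin θ ≠ 0 :=
    (Real.sin_pos_of_pos_of_lt_pi (Real.arccos_pos.2 ht₂) (Real.arccos_lt_pi.2 ht₁)).ne'
  have hinner := (hcosθ ▸ h).star_slerp_dotProduct_slerp hsinθ
  obtain ⟨α, hα⟩ := exists_mul_cos_add_mul_cos_eq p q (2 * θ - 2 * Real.arccos c)
  refine ⟨slerp u v θ (α / 2), slerp u v θ (α / 2 + Real.arccos c), ⟨?_, ?_, ?_⟩, ?_⟩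
  · rw [hinner, sub_self, Real.cos_zero, Complex.ofReal_one]
  · rw [hinner, sub_self, Real.cos_zero, Complex.ofReal_one]
  · rw [hinner, sub_add_cancel_left, Real.cos_neg, Real.cos_arccos hc₁ hc₂]
  · have hu : overlapSq u (slerp u v θ (α / 2)) = 1 / 2 + Real.cos α / 2 := by
      nth_rw 1 [← slerp_zero hsinθ u v]
      rw [overlapSq, hinner, Complex.norm_real, Real.norm_eq_abs, sq_abs, zero_sub, Real.cos_neg,
        Real.cos_sq, mul_div_cancel₀ α two_ne_zero]
    have hv : overlapSq v (slerp u v θ (α / 2 + Real.arccos c)) =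
        1 / 2 + Real.cos (2 * θ - 2 * Real.arccos c - α) / 2 := by
      nth_rw 1 [← slerp_self hsinθ u v]
      rw [overlapSq, hinner, Complex.norm_real, Real.norm_eq_abs, sq_abs, Real.cos_sq]
      ring_nf
    rw [hu, hv, trackingOptimum, ← neg_sub (2 * θ), Real.cos_neg, ← hα]
    linear_combination (1 / 2) * hpq

end UnitPair

section Gram

variable {𝕜 V ι : Type*} [RCLike 𝕜] [NormedAddCommGroup V] [InnerProductSpace 𝕜 V]
  {f g : ι → V}

lemma norm_linearCombination_eq_of_gram_eq [Fintype ι] (h : Matrix.gram 𝕜 f = Matrix.gram 𝕜 g)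
    (a : ι → 𝕜) :
    ‖Fintype.linearCombination 𝕜 f a‖ = ‖Fintype.linearCombination 𝕜 g a‖ := by
  have hinner : inner 𝕜 (Fintype.linearCombination 𝕜 f a) (Fintype.linearCombination 𝕜 f a) =
      inner 𝕜 (Fintype.linearCombination 𝕜 g a) (Fintype.linearCombination 𝕜 g a) := by
    simp only [Fintype.linearCombination_apply, ← Matrix.star_dotProduct_gram_mulVec, h]
  rw [norm_eq_sqrt_re_inner (𝕜 := 𝕜), hinner, ← norm_eq_sqrt_re_inner]

lemma exists_linearIsometry_apply_eq_of_gram_eq [Finite ι] [FiniteDimensional 𝕜 V]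
    (h : Matrix.gram 𝕜 f = Matrix.gram 𝕜 g) : ∃ L : V →ₗᵢ[𝕜] V, ∀ i, L (f i) = g i := by
  classical
  cases nonempty_fintype ι
  let F := Fintype.linearCombination 𝕜 f
  let G := Fintype.linearCombination 𝕜 g
  have hnorm (a : ι → 𝕜) : ‖F a‖ = ‖G a‖ := norm_linearCombination_eq_of_gram_eq h a
  obtain ⟨r, hr⟩ := F.rangeRestrict.exists_rightInverse_of_surjective F.range_rangeRestrict
  have hFr (x : LinearMap.range F) : F (r x) = x :=
    congrArg Subtype.val (LinearMap.congr_fun hr x)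
  let L₀ : LinearMap.range F →ₗᵢ[𝕜] V :=
    ⟨G ∘ₗ r, fun x => by rw [LinearMap.comp_apply, ← hnorm, hFr, Submodule.coe_norm]⟩
  have hF (i : ι) : F (Pi.single i 1) = f i := by
    rw [Fintype.linearCombination_apply_single, one_smul]
  have hG (i : ι) : G (Pi.single i 1) = g i := by
    rw [Fintype.linearCombination_apply_single, one_smul]
  refine ⟨L₀.extend, fun i => ?_⟩
  let x : LinearMap.range F := ⟨f i, Pi.single i 1, hF i⟩
  have hker : G (r x) = G (Pi.single i 1) := by
    rw [← sub_eq_zero, ← map_sub, ← norm_eq_zero, ← hnorm, map_sub, hFr, hF, sub_self, norm_zero]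
  calc L₀.extend (f i) = L₀ x := L₀.extend_apply x
    _ = g i := hker.trans (hG i)

end Gram

section Unitary

variable {ι : Type*} [Fintype ι] [DecidableEq ι]

lemma exists_unitary_toLp_mulVec_eq (L : EuclideanSpace ℂ ι →ₗᵢ[ℂ] EuclideanSpace ℂ ι) :
    ∃ U : Matrix.unitaryGroup ι ℂ, ∀ x : ι → ℂ,
      WithLp.toLp 2 (U.1 *ᵥ x) = L (WithLp.toLp 2 x) := by
  obtain ⟨U, hU⟩ := EquivLike.surjective (Matrix.toEuclideanCLM (n := ι) (𝕜 := ℂ))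
    L.toContinuousLinearMap
  have hunitary : U ∈ Matrix.unitaryGroup ι ℂ := by
    rw [Matrix.mem_unitaryGroup_iff']
    apply EquivLike.injective (Matrix.toEuclideanCLM (n := ι) (𝕜 := ℂ))
    rw [map_mul, map_star, map_one, hU]
    exact (ContinuousLinearMap.norm_map_iff_adjoint_comp_self _).1 L.norm_map
  exact ⟨⟨U, hunitary⟩, fun x => by
    rw [← Matrix.toEuclideanCLM_toLp, hU, LinearIsometry.coe_toContinuousLinearMap]⟩

lemma UnitPair.exists_unitary_mulVec_eq {x y u v : ι → ℂ} {c : ℝ} (h : UnitPair x y c)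
    (h' : UnitPair u v c) : ∃ U : Matrix.unitaryGroup ι ℂ, U.1 *ᵥ x = u ∧ U.1 *ᵥ y = v := by
  have hgram : Matrix.gram ℂ (fun i => WithLp.toLp 2 (![x, y] i)) =
      Matrix.gram ℂ (fun i => WithLp.toLp 2 (![u, v] i)) := by
    ext i j
    rw [Matrix.gram_apply, Matrix.gram_apply, inner_toLp_toLp, inner_toLp_toLp]
    fin_cases i <;> fin_cases j <;>
      simp [h.left, h.right, h.overlap, h.overlap_symm, h'.left, h'.right, h'.overlap,
        h'.overlap_symm]
  obtain ⟨L, hL⟩ := exists_linearIsometry_apply_eq_of_gram_eq hgram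
  obtain ⟨U, hU⟩ := exists_unitary_toLp_mulVec_eq L
  exact ⟨U, WithLp.toLp_injective 2 ((hU x).trans (hL 0)),
    WithLp.toLp_injective 2 ((hU y).trans (hL 1))⟩

lemma exists_conjTranspose_mul_self_eq_one {κ : Type*} [Fintype κ]
    (h : Fintype.card ι ≤ Fintype.card κ) : ∃ J : Matrix κ ι ℂ, Jᴴ * J = 1 := by
  classical
  obtain ⟨e⟩ := Function.Embedding.nonempty_of_card_le h
  refine ⟨(1 : Matrix κ κ ℂ).submatrix id e, ?_⟩
  rw [Matrix.conjTranspose_submatrix, Matrix.conjTranspose_one,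
    ← Matrix.submatrix_mul _ _ _ id _ Function.bijective_id, one_mul,
    Matrix.submatrix_one _ e.injective]

end Unitary

section CompletelyPositive

variable {ι κ : Type*} [Fintype ι] [Fintype κ]

/-- Conjugation by an isometry, as a homomorphism of star algebras. -/
noncomputable def isometryConj [DecidableEq ι] (W : Matrix κ ι ℂ) (hW : Wᴴ * W = 1) :
    CStarMatrix ι ι ℂ →⋆ₙₐ[ℂ] CStarMatrix κ κ ℂ where
  toFun X := CStarMatrix.ofMatrix (W * CStarMatrix.ofMatrix.symm X * Wᴴ)
  map_smul' c X := by
    change W * (c • CStarMatrix.ofMatrix.symm X) * Wᴴ = c • (W * CStarMatrix.ofMatrix.symm X * Wᴴ)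
    rw [Matrix.mul_smul, Matrix.smul_mul]
  map_zero' := by
    change W * (0 : Matrix ι ι ℂ) * Wᴴ = 0
    rw [Matrix.mul_zero, Matrix.zero_mul]
  map_add' X Y := by
    change W * (CStarMatrix.ofMatrix.symm X + CStarMatrix.ofMatrix.symm Y) * Wᴴ =
      W * CStarMatrix.ofMatrix.symm X * Wᴴ + W * CStarMatrix.ofMatrix.symm Y * Wᴴ
    rw [Matrix.mul_add, Matrix.add_mul]
  map_mul' X Y := by
    change W * (CStarMatrix.ofMatrix.symm X * CStarMatrix.ofMatrix.symm Y) * Wᴴ =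
      W * CStarMatrix.ofMatrix.symm X * Wᴴ * (W * CStarMatrix.ofMatrix.symm Y * Wᴴ)
    simp only [Matrix.mul_assoc]
    rw [← Matrix.mul_assoc Wᴴ W, hW, Matrix.one_mul]
  map_star' X := by
    change W * (CStarMatrix.ofMatrix.symm X)ᴴ * Wᴴ = (W * CStarMatrix.ofMatrix.symm X * Wᴴ)ᴴ
    rw [Matrix.conjTranspose_mul, Matrix.conjTranspose_mul, Matrix.conjTranspose_conjTranspose,
      Matrix.mul_assoc]

/-- The block matrix `∑ᵢⱼ Eᵢⱼ ⊗ Eᵢⱼ` of matrix units, an unnormalised maximally entangled state. -/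
def matrixUnits (ι : Type*) [DecidableEq ι] : CStarMatrix ι ι (CStarMatrix ι ι ℂ) :=
  CStarMatrix.ofMatrix fun i j => CStarMatrix.ofMatrix (Matrix.single i j 1)

lemma matrixUnits_nonneg [DecidableEq ι] : 0 ≤ matrixUnits ι := by
  rcases isEmpty_or_nonempty ι with hι | ⟨⟨o⟩⟩
  · exact le_of_eq (CStarMatrix.ext fun i => hι.elim i)
  let R : CStarMatrix ι ι (CStarMatrix ι ι ℂ) := CStarMatrix.ofMatrix fun k j =>
    if k = o then CStarMatrix.ofMatrix (Matrix.single o j 1) else 0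
  have hrow (j : ι) : R o j = CStarMatrix.ofMatrix (Matrix.single o j 1) := if_pos rfl
  have hzero {k : ι} (hk : k ≠ o) (j : ι) : R k j = 0 := if_neg hk
  have hR : matrixUnits ι = star R * R := by
    ext1 i j
    rw [CStarMatrix.mul_apply, Finset.sum_eq_single o (fun k _ hk => by rw [hzero hk j, mul_zero])
      (fun ho => absurd (Finset.mem_univ o) ho), CStarMatrix.star_apply, hrow, hrow]
    have hunit : Matrix.single i j (1 : ℂ) = (Matrix.single o i 1)ᴴ * Matrix.single o j 1 := by
      rw [Matrix.conjTranspose_single, Matrix.single_mul_single_same, star_one, one_mul]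
    exact congrArg CStarMatrix.ofMatrix hunit
  rw [hR]
  exact star_mul_self_nonneg R

-- Abstracting the algebra is needed: on nested `CStarMatrix` types the instances of the functional
-- calculus behind this equivalence are not found.
lemma exists_eq_star_mul_self_of_nonneg {A : Type*} [NonUnitalCStarAlgebra A] [PartialOrder A]
    [StarOrderedRing A] {a : A} (ha : 0 ≤ a) : ∃ b, a = star b * b :=
  CStarAlgebra.nonneg_iff_eq_star_mul_self.1 ha

lemma exists_apply_single_eq_sum_conjTranspose_mul [DecidableEq ι]
    (C : CompletelyPositiveMap (CStarMatrix ι ι ℂ) (CStarMatrix κ κ ℂ)) :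
    ∃ B : ι → ι → Matrix κ κ ℂ, ∀ i j,
      C (CStarMatrix.ofMatrix (Matrix.single i j 1)) =
        CStarMatrix.ofMatrix (∑ k, (B k i)ᴴ * B k j) := by
  obtain ⟨N, hN⟩ := exists_eq_star_mul_self_of_nonneg
    (CompletelyPositiveMap.map_cstarMatrix_nonneg C _ (matrixUnits_nonneg (ι := ι)))
  exact ⟨fun k i => CStarMatrix.ofMatrix.symm (N k i), fun i j =>
    (congrFun (congrFun hN i) j).trans CStarMatrix.mul_apply⟩

theorem completelyPositiveMap_exists_kraus
    (C : CompletelyPositiveMap (CStarMatrix ι ι ℂ) (CStarMatrix κ κ ℂ)) :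
    ∃ K : ι × κ → Matrix κ ι ℂ, ∀ X : Matrix ι ι ℂ,
      C (CStarMatrix.ofMatrix X) = CStarMatrix.ofMatrix (∑ k, K k * X * (K k)ᴴ) := by
  classical
  obtain ⟨B, hB⟩ := exists_apply_single_eq_sum_conjTranspose_mul C
  let K : ι × κ → Matrix κ ι ℂ := fun k => Matrix.of fun a i => star (B k.1 i k.2 a)
  have hunit (i j : ι) :
      ∑ k, (B k i)ᴴ * B k j = ∑ k, K k * Matrix.single i j (1 : ℂ) * (K k)ᴴ := by
    ext a b
    have hentry (k : ι × κ) : (K k * Matrix.single i j (1 : ℂ) * (K k)ᴴ) a b =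
        star (B k.1 i k.2 a) * B k.1 j k.2 b := by
      rw [Matrix.single_eq_single_vecMulVec_single, Matrix.mul_vecMulVec, Matrix.vecMulVec_mul,
        Matrix.mulVec_single_one, Matrix.single_one_vecMul, Matrix.vecMulVec_apply]
      exact congrArg _ (star_star (B k.1 j k.2 b))
    simp only [Matrix.sum_apply, Matrix.mul_apply, Matrix.conjTranspose_apply, hentry,
      Fintype.sum_prod_type]
  let Φ : Matrix ι ι ℂ →ₗ[ℂ] Matrix κ κ ℂ :=
    ∑ k, (mulRightLinearMap κ ℂ (K k)ᴴ) ∘ₗ (mulLeftLinearMap ι ℂ (K k))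
  have hΦ (X : Matrix ι ι ℂ) : Φ X = ∑ k, K k * X * (K k)ᴴ := by
    rw [LinearMap.sum_apply]
    rfl
  have hC : C.toLinearMap ∘ₗ (CStarMatrix.ofMatrixₗ (R := ℂ)).toLinearMap =
      (CStarMatrix.ofMatrixₗ (R := ℂ)).toLinearMap ∘ₗ Φ := by
    refine Matrix.ext_linearMap _ fun i j => LinearMap.ext_ring ?_
    exact (hB i j).trans (congrArg CStarMatrix.ofMatrix ((hunit i j).trans (hΦ _).symm))
  exact ⟨K, fun X => (LinearMap.congr_fun hC X).trans (congrArg CStarMatrix.ofMatrix (hΦ X))⟩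

end CompletelyPositive

section Stinespring

variable {ι κ ν : Type*} [Fintype ι] [Fintype κ] [Fintype ν]

lemma trace_mul_vecMulVec_mul_conjTranspose_mul_vecMulVec
    (K : Matrix κ ι ℂ) (s : ι → ℂ) (t : κ → ℂ) :
    (K * Matrix.vecMulVec s (star s) * Kᴴ * Matrix.vecMulVec t (star t)).trace =
      overlapSq t (K *ᵥ s) := by
  rw [Matrix.mul_vecMulVec K, Matrix.vecMulVec_mul, ← Matrix.star_mulVec,
    Matrix.vecMulVec_mul_vecMulVec, Matrix.trace_vecMulVec, overlapSq, dotProduct_smul,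
    dotProduct_comm (K *ᵥ s), Matrix.star_dotProduct (K *ᵥ s), smul_eq_mul,
    Complex.star_def, ← Complex.normSq_eq_conj_mul_self, Complex.normSq_eq_norm_sq]

/-- The matrix of blocks `K k` stacked on top of each other: for Kraus operators `K` of a quantum
operation, the Stinespring isometry `s ↦ ∑ₖ |k⟩ ⊗ K k |s⟩`. -/
def blockColumn {ι κ ν : Type*} (K : ν → Matrix κ ι ℂ) : Matrix (ν × κ) ι ℂ :=
  Matrix.of fun p i => K p.1 p.2 i

lemma conjTranspose_blockColumn_mul_blockColumn {ι κ ν : Type*} [Fintype κ] [Fintype ν]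
    (K : ν → Matrix κ ι ℂ) : (blockColumn K)ᴴ * blockColumn K = ∑ k, (K k)ᴴ * K k := by
  ext i j
  simp only [blockColumn, Matrix.mul_apply, Matrix.sum_apply, Matrix.conjTranspose_apply,
    Matrix.of_apply, Fintype.sum_prod_type]

lemma exists_norm_eq_one_inner_eq_norm {𝕜 E : Type*} [RCLike 𝕜] [NormedAddCommGroup E]
    [InnerProductSpace 𝕜 E] [Nontrivial E] (x : E) :
    ∃ e : E, ‖e‖ = 1 ∧ inner 𝕜 e x = (‖x‖ : 𝕜) := by
  rcases eq_or_ne x 0 with rfl | hx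
  · let _ := NormedSpace.restrictScalars ℝ 𝕜 E
    obtain ⟨e, he⟩ := exists_norm_eq E zero_le_one
    exact ⟨e, he, by rw [inner_zero_right, norm_zero, RCLike.ofReal_zero]⟩
  · have hx' : (‖x‖ : 𝕜) ≠ 0 := RCLike.ofReal_ne_zero.2 (norm_ne_zero_iff.2 hx)
    refine ⟨(‖x‖ : 𝕜)⁻¹ • x, norm_smul_inv_norm hx, ?_⟩
    rw [inner_smul_left, map_inv₀, RCLike.conj_ofReal, inner_self_eq_norm_sq_to_K, sq,
      inv_mul_cancel_left₀ hx']

/-- Uhlmann's theorem for a pure target: the fidelity of the reduced state of `w` with `t` is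
attained by an extension `e ⊗ t` of `t`. -/
lemma exists_overlapSq_tensor_eq_sum [Nonempty ν] (t : κ → ℂ) (w : ν × κ → ℂ) :
    ∃ e : ν → ℂ, star e ⬝ᵥ e = 1 ∧
      overlapSq (tensor e t) w = ∑ k, overlapSq t (fun a => w (k, a)) := by
  let f : EuclideanSpace ℂ ν := WithLp.toLp 2 fun k => star t ⬝ᵥ fun a => w (k, a)
  obtain ⟨e, he, hef⟩ := exists_norm_eq_one_inner_eq_norm (𝕜 := ℂ) f
  refine ⟨e.ofLp, ?_, ?_⟩
  · rw [← inner_toLp_toLp, inner_self_eq_norm_sq_to_K, WithLp.toLp_ofLp, he, RCLike.ofReal_one,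
      one_pow]
  · have htensor : star (tensor e.ofLp t) ⬝ᵥ w = inner ℂ e f := by
      rw [← WithLp.toLp_ofLp 2 e, inner_toLp_toLp]
      simp only [dotProduct, tensor, Fintype.sum_prod_type, Pi.star_apply, star_mul',
        Finset.mul_sum, mul_assoc]
    rw [overlapSq, htensor, hef, RCLike.norm_ofReal, abs_norm, EuclideanSpace.norm_sq_eq]
    rfl

end Stinespring

section QuantumOperation

variable {ι κ : Type} [Fintype ι] [DecidableEq ι] [Fintype κ] [DecidableEq κ]

/-- The quantum operation `X ↦ W X Wᴴ` of an isometry `W`. -/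
noncomputable def QuantumOperation.ofIsometry (W : Matrix κ ι ℂ) (hW : Wᴴ * W = 1) :
    QuantumOperation ι κ where
  toCP := CompletelyPositiveMapClass.toCompletelyPositiveLinearMap (isometryConj W hW)
  tr_map X := by
    change Matrix.trace (W * CStarMatrix.ofMatrix.symm X * Wᴴ) = Matrix.trace _
    rw [Matrix.trace_mul_comm, ← Matrix.mul_assoc, hW, Matrix.one_mul]

lemma tr_ofIsometry_pureState_mul_pureState (W : Matrix κ ι ℂ) (hW : Wᴴ * W = 1) (s : ι → ℂ)
    (t : κ → ℂ) :
    tr ((QuantumOperation.ofIsometry W hW).toCP (pureState s) * pureState t) =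
      overlapSq t (W *ᵥ s) :=
  trace_mul_vecMulVec_mul_conjTranspose_mul_vecMulVec W s t

theorem QuantumOperation.exists_kraus (C : QuantumOperation ι κ) :
    ∃ K : ι × κ → Matrix κ ι ℂ, ∑ k, (K k)ᴴ * K k = 1 ∧ ∀ X : Matrix ι ι ℂ,
      C.toCP (CStarMatrix.ofMatrix X) = CStarMatrix.ofMatrix (∑ k, K k * X * (K k)ᴴ) := by
  obtain ⟨K, hK⟩ := completelyPositiveMap_exists_kraus C.toCP
  refine ⟨K, Matrix.ext_iff_trace_mul_right.2 fun X => ?_, hK⟩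
  have htr : (∑ k, K k * X * (K k)ᴴ).trace = X.trace := by
    have h := C.tr_map (CStarMatrix.ofMatrix X)
    rwa [hK] at h
  rw [Matrix.one_mul, ← htr]
  simp only [Finset.sum_mul, Matrix.trace_sum]
  exact Finset.sum_congr rfl fun k _ => by rw [Matrix.mul_assoc, Matrix.trace_mul_comm]

theorem QuantumOperation.exists_stinespring (C : QuantumOperation ι κ) :
    ∃ W : Matrix ((ι × κ) × κ) ι ℂ, Wᴴ * W = 1 ∧ ∀ (s : ι → ℂ) (t : κ → ℂ),
      tr (C.toCP (pureState s) * pureState t) =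
        ∑ k, overlapSq t (fun a => (W *ᵥ s) (k, a)) := by
  obtain ⟨K, hK₁, hK⟩ := C.exists_kraus
  refine ⟨blockColumn K, (conjTranspose_blockColumn_mul_blockColumn K).trans hK₁, fun s t => ?_⟩
  have hblock (k : ι × κ) : (fun a => (blockColumn K *ᵥ s) (k, a)) = K k *ᵥ s := rfl
  calc tr (C.toCP (pureState s) * pureState t)
      = ((∑ k, K k * Matrix.vecMulVec s (star s) * (K k)ᴴ) *
          Matrix.vecMulVec t (star t)).trace := by
        rw [pureState, hK]
        rfl
    _ = ∑ k, overlapSq t (fun a => (blockColumn K *ᵥ s) (k, a)) := by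
        simp only [Finset.sum_mul, Matrix.trace_sum, hblock, Complex.ofReal_sum,
          trace_mul_vecMulVec_mul_conjTranspose_mul_vecMulVec]

end QuantumOperation

section Optimality

variable {p q c t : ℝ}

theorem isGreatest_overlapSq_unitary {ι : Type*} [Fintype ι] [DecidableEq ι] {s₁ s₂ t₁ t₂ : ι → ℂ}
    (hp : 0 ≤ p) (hq : 0 ≤ q) (hpq : p + q = 1) (ht₀ : 0 ≤ t) (htc : t ≤ c) (ht₁ : t < 1)
    (hs : UnitPair s₁ s₂ c) (ht : UnitPair t₁ t₂ t) :
    IsGreatest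
      (Set.range fun U : Matrix.unitaryGroup ι ℂ =>
        p * overlapSq t₁ (U.1 *ᵥ s₁) + q * overlapSq t₂ (U.1 *ᵥ s₂))
      (trackingOptimum p q c t) := by
  constructor
  · obtain ⟨x, y, hxy, hopt⟩ :=
      ht.exists_optimal (by rwa [abs_of_nonneg ht₀]) hs.abs_le_one hpq
    obtain ⟨U, hx, hy⟩ := hs.exists_unitary_mulVec_eq hxy
    exact ⟨U, by simp only [hx, hy, hopt]⟩
  · rintro _ ⟨U, rfl⟩
    have hUs := hs.mulVec (Unitary.coe_star_mul_self U)
    exact mul_overlapSq_add_le_trackingOptimum hp hq hpq htc hUs.left hUs.right ht.left ht.right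
      (hUs.norm_overlap ▸ le_abs_self c) (by rw [ht.norm_overlap, abs_of_nonneg ht₀])

variable {ι κ : Type} [Fintype ι] [DecidableEq ι] [Fintype κ] [DecidableEq κ] {s₁ s₂ : ι → ℂ}
  {t₁ t₂ : κ → ℂ}

lemma trackingFidelity_ofIsometry (W : Matrix κ ι ℂ) (hW : Wᴴ * W = 1) :
    trackingFidelity p q s₁ s₂ t₁ t₂ (QuantumOperation.ofIsometry W hW) =
      p * overlapSq t₁ (W *ᵥ s₁) + q * overlapSq t₂ (W *ᵥ s₂) := by
  simp only [trackingFidelity, tr_ofIsometry_pureState_mul_pureState, Complex.ofReal_re]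

theorem trackingFidelity_le_trackingOptimum (hp : 0 ≤ p) (hq : 0 ≤ q) (hpq : p + q = 1)
    (ht₀ : 0 ≤ t) (htc : t ≤ c) (hs : UnitPair s₁ s₂ c) (ht : UnitPair t₁ t₂ t)
    (C : QuantumOperation ι κ) :
    trackingFidelity p q s₁ s₂ t₁ t₂ C ≤ trackingOptimum p q c t := by
  obtain ⟨W, hW, hC⟩ := C.exists_stinespring
  have hWs := hs.mulVec hW
  have : Nonempty (ι × κ) := by
    by_contra hempty
    rw [not_nonempty_iff] at hempty
    simpa [dotProduct] using hWs.left
  obtain ⟨e₁, he₁, hf₁⟩ := exists_overlapSq_tensor_eq_sum t₁ (W *ᵥ s₁)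
  obtain ⟨e₂, he₂, hf₂⟩ := exists_overlapSq_tensor_eq_sum t₂ (W *ᵥ s₂)
  have htarget : ‖star (tensor e₁ t₁) ⬝ᵥ tensor e₂ t₂‖ ≤ t := by
    rw [star_tensor_dotProduct_tensor, norm_mul, ht.norm_overlap, abs_of_nonneg ht₀]
    exact mul_le_of_le_one_left ht₀ (norm_star_dotProduct_le_one he₁ he₂)
  calc trackingFidelity p q s₁ s₂ t₁ t₂ C
      = p * overlapSq (tensor e₁ t₁) (W *ᵥ s₁) + q * overlapSq (tensor e₂ t₂) (W *ᵥ s₂) := by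
        rw [trackingFidelity, hC, hC, Complex.ofReal_re, Complex.ofReal_re, hf₁, hf₂]
    _ ≤ trackingOptimum p q c t :=
        mul_overlapSq_add_le_trackingOptimum hp hq hpq htc hWs.left hWs.right
          (by rw [star_tensor_dotProduct_tensor, he₁, ht.left, one_mul])
          (by rw [star_tensor_dotProduct_tensor, he₂, ht.right, one_mul])
          (hWs.norm_overlap ▸ le_abs_self c) htarget

theorem isGreatest_trackingFidelity (hcard : Fintype.card ι ≤ Fintype.card κ) (hp : 0 ≤ p)
    (hq : 0 ≤ q) (hpq : p + q = 1) (ht₀ : 0 ≤ t) (htc : t ≤ c) (ht₁ : t < 1)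
    (hs : UnitPair s₁ s₂ c) (ht : UnitPair t₁ t₂ t) :
    IsGreatest (Set.range (trackingFidelity p q s₁ s₂ t₁ t₂)) (trackingOptimum p q c t) := by
  constructor
  · obtain ⟨J, hJ⟩ := exists_conjTranspose_mul_self_eq_one hcard
    obtain ⟨U, hU⟩ :=
      (isGreatest_overlapSq_unitary hp hq hpq ht₀ htc ht₁ (hs.mulVec hJ) ht).1
    have hUJ : (U.1 * J)ᴴ * (U.1 * J) = 1 := by
      rw [Matrix.conjTranspose_mul, Matrix.mul_assoc, ← Matrix.mul_assoc U.1ᴴ,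
        ← Matrix.star_eq_conjTranspose U.1, Unitary.coe_star_mul_self, Matrix.one_mul, hJ]
    refine ⟨QuantumOperation.ofIsometry (U.1 * J) hUJ, ?_⟩
    rw [trackingFidelity_ofIsometry, ← Matrix.mulVec_mulVec, ← Matrix.mulVec_mulVec]
    exact hU
  · rintro _ ⟨C, rfl⟩
    exact trackingFidelity_le_trackingOptimum hp hq hpq ht₀ htc hs ht C

end Optimality

section Qubit

variable {φ : ℝ}

lemma unitPair_ketA_ketB (φ : ℝ) : UnitPair (ketA φ) (ketB φ) (Real.sin (2 * φ)) := by
  have hsq : (Real.sin φ : ℂ) ^ 2 + (Real.cos φ : ℂ) ^ 2 = 1 := by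
    exact_mod_cast Real.sin_sq_add_cos_sq φ
  constructor <;>
    simp only [ketA, ketB, dotProduct, Fin.sum_univ_two, Pi.star_apply, Matrix.cons_val_zero,
      Matrix.cons_val_one, RCLike.star_def, Complex.conj_ofReal, Real.sin_two_mul,
      Complex.ofReal_mul, Complex.ofReal_ofNat]
  · linear_combination hsq
  · linear_combination hsq
  · ring

lemma unitPair_ket0_ket0 : UnitPair ket0 ket0 1 := by
  constructor <;> simp [ket0, dotProduct, Fin.sum_univ_two]

lemma sin_two_mul_mem_Ico (hφ : φ ∈ Set.Ico 0 (Real.pi / 4)) :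
    Real.sin (2 * φ) ∈ Set.Ico (0 : ℝ) 1 := by
  obtain ⟨hφ₀, hφ₁⟩ := hφ
  refine ⟨Real.sin_nonneg_of_nonneg_of_le_pi (by linarith) (by linarith), ?_⟩
  rw [← Real.sin_pi_div_two]
  exact Real.sin_lt_sin_of_lt_of_le_pi_div_two (by linarith) le_rfl (by linarith)

lemma sin_two_mul_sq_le (hφ : φ ∈ Set.Ico 0 (Real.pi / 4)) :
    Real.sin (2 * φ) ^ 2 ≤ Real.sin (2 * φ) :=
  let ⟨h₀, h₁⟩ := sin_two_mul_mem_Ico hφ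
  pow_le_of_le_one h₀ h₁.le two_ne_zero

lemma sin_two_mul_sq_lt_one (hφ : φ ∈ Set.Ico 0 (Real.pi / 4)) : Real.sin (2 * φ) ^ 2 < 1 :=
  (sin_two_mul_sq_le hφ).trans_lt (sin_two_mul_mem_Ico hφ).2

lemma indicator_nonpos (hφ : φ ∈ Set.Ico 0 (Real.pi / 4)) : indicator φ ≤ 0 := by
  rw [indicator, ← mul_sub]
  have := Real.arccos_le_arccos (sin_two_mul_sq_le hφ)
  linarith

lemma trackingOptimum_half_sq {s : ℝ} (hs₀ : 0 ≤ s) (hs₁ : s ≤ 1) :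
    trackingOptimum (1 / 2) (1 / 2) s (s ^ 2) =
      1 / 4 * (√(1 + s ^ 2) * √(1 + s) + √(1 - s ^ 2) * √(1 - s)) ^ 2 := by
  have hsq : s ^ 2 ≤ 1 := pow_le_one₀ hs₀ hs₁
  have h₁ : √(1 - s ^ 2) = √(1 + s) * √(1 - s) := by
    rw [← Real.sqrt_mul (by linarith)]
    ring_nf
  have h₂ : √(1 - (s ^ 2) ^ 2) = √(1 - s ^ 2) * √(1 + s ^ 2) := by
    rw [← Real.sqrt_mul (by linarith)]
    ring_nf
  have hadd := Real.sq_sqrt (show 0 ≤ 1 + s by linarith)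
  have hsub := Real.sq_sqrt (show 0 ≤ 1 - s by linarith)
  have hadd_sq := Real.sq_sqrt (show 0 ≤ 1 + s ^ 2 by positivity)
  rw [trackingOptimum_half hs₀ hs₁ (sq_nonneg s) hsq, h₂, h₁]
  calc 1 / 2 + 1 / 2 * (s * s ^ 2 +
          √(1 + s) * √(1 - s) * (√(1 + s) * √(1 - s) * √(1 + s ^ 2)))
      = 1 / 2 + 1 / 2 * (s * s ^ 2 + √(1 + s) ^ 2 * √(1 - s) ^ 2 * √(1 + s ^ 2)) := by ring
    _ = 1 / 4 * ((1 + s) * (√(1 + s ^ 2) ^ 2 + 2 * √(1 + s ^ 2) * (1 - s) + (1 - s) ^ 2)) := by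
        rw [hadd, hsub, hadd_sq]
        ring
    _ = 1 / 4 * (√(1 + s) ^ 2 * (√(1 + s ^ 2) + √(1 - s) ^ 2) ^ 2) := by
        rw [hadd, hsub]
        ring
    _ = 1 / 4 * (√(1 + s ^ 2) * √(1 + s) + √(1 + s) * √(1 - s) * √(1 - s)) ^ 2 := by ring

lemma optimalFidelity_half_half (hφ : φ ∈ Set.Ico 0 (Real.pi / 4)) :
    optimalFidelity (1 / 2) (1 / 2) φ = brussFidelity φ := by
  obtain ⟨hs₀, hs₁⟩ := sin_two_mul_mem_Ico hφ
  rw [brussFidelity, Real.cos_eq_sqrt_one_sub_sin_sq (by linarith [hφ.1, Real.pi_pos])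
    (by linarith [hφ.2])]
  exact trackingOptimum_half_sq hs₀ hs₁.le

theorem isGreatest_globalFidelity {p q : ℝ} (hp : 0 ≤ p) (hq : 0 ≤ q) (hpq : p + q = 1)
    (hφ : φ ∈ Set.Ico 0 (Real.pi / 4)) :
    IsGreatest (Set.range (globalFidelity p q φ)) (optimalFidelity p q φ) := by
  have hab := unitPair_ketA_ketB φ
  have hblank := hab.tensor unitPair_ket0_ket0
  have htarget := hab.tensor hab
  rw [mul_one] at hblank
  rw [← sq] at htarget
  exact isGreatest_overlapSq_unitary hp hq hpq (sq_nonneg _) (sin_two_mul_sq_le hφ)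
    (sin_two_mul_sq_lt_one hφ) hblank htarget

theorem isGreatest_trackingFidelity_optimalFidelity {ι κ : Type} [Fintype ι] [DecidableEq ι]
    [Fintype κ] [DecidableEq κ] {p q : ℝ} {s₁ s₂ : ι → ℂ} {t₁ t₂ : κ → ℂ}
    (hcard : Fintype.card ι ≤ Fintype.card κ) (hp : 0 ≤ p) (hq : 0 ≤ q) (hpq : p + q = 1)
    (hφ : φ ∈ Set.Ico 0 (Real.pi / 4)) (hs : UnitPair s₁ s₂ (Real.sin (2 * φ)))
    (ht : UnitPair t₁ t₂ (Real.sin (2 * φ) ^ 2)) :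
    IsGreatest (Set.range (trackingFidelity p q s₁ s₂ t₁ t₂)) (optimalFidelity p q φ) :=
  isGreatest_trackingFidelity hcard hp hq hpq (sq_nonneg _) (sin_two_mul_sq_le hφ)
    (sin_two_mul_sq_lt_one hφ) hs ht

end Qubit

end Cloning

theorem mainTheorem5 (φ : ℝ) (hφ : φ ∈ Set.Ico 0 (Real.pi / 4)) :
    Cloning.indicator φ ≤ 0 ∧
    (∀ π₁ π₂ : ℝ, 0 ≤ π₁ → 0 ≤ π₂ → π₁ + π₂ = 1 →
      -- two-qubit cloning unitaries
      IsGreatest (Set.range (Cloning.globalFidelity π₁ π₂ φ)) (Cloning.optimalFidelity π₁ π₂ φ) ∧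
      -- arbitrary quantum operations from one qubit to two qubits
      IsGreatest
        (Set.range (Cloning.trackingFidelity π₁ π₂ (Cloning.ketA φ) (Cloning.ketB φ)
          (Cloning.tensor (Cloning.ketA φ) (Cloning.ketA φ))
          (Cloning.tensor (Cloning.ketB φ) (Cloning.ketB φ))))
        (Cloning.optimalFidelity π₁ π₂ φ) ∧
      -- quantum operations between fictitious qubit sources and targets with overlaps `⟨a0|b0⟩` and `⟨aa|bb⟩`
      (∀ s₁ s₂ t₁ t₂ : Fin 2 → ℂ,
        star s₁ ⬝ᵥ s₁ = 1 → star s₂ ⬝ᵥ s₂ = 1 → star t₁ ⬝ᵥ t₁ = 1 → star t₂ ⬝ᵥ t₂ = 1 →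
        star s₁ ⬝ᵥ s₂ = ((Real.sin (2 * φ) : ℝ) : ℂ) →
        star t₁ ⬝ᵥ t₂ = ((Real.sin (2 * φ) ^ 2 : ℝ) : ℂ) →
        IsGreatest (Set.range (Cloning.trackingFidelity π₁ π₂ s₁ s₂ t₁ t₂))
          (Cloning.optimalFidelity π₁ π₂ φ))) ∧
    -- equal priors: the optimum of Bruß et al.
    Cloning.optimalFidelity (1 / 2) (1 / 2) φ = Cloning.brussFidelity φ ∧
    IsGreatest (Set.range (Cloning.globalFidelity (1 / 2) (1 / 2) φ))
      (Cloning.brussFidelity φ) := by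
  have hab := Cloning.unitPair_ketA_ketB φ
  refine ⟨Cloning.indicator_nonpos hφ, fun π₁ π₂ h₁ h₂ h => ⟨?_, ?_, ?_⟩, ?_, ?_⟩
  · exact Cloning.isGreatest_globalFidelity h₁ h₂ h hφ
  · exact Cloning.isGreatest_trackingFidelity_optimalFidelity (by simp) h₁ h₂ h hφ hab
      (sq (Real.sin (2 * φ)) ▸ hab.tensor hab)
  · intro s₁ s₂ t₁ t₂ hs₁ hs₂ ht₁ ht₂ hs ht
    exact Cloning.isGreatest_trackingFidelity_optimalFidelity le_rfl h₁ h₂ h hφ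
      ⟨hs₁, hs₂, hs⟩ ⟨ht₁, ht₂, ht⟩
  · exact Cloning.optimalFidelity_half_half hφ
  · rw [← Cloning.optimalFidelity_half_half hφ]
    exact Cloning.isGreatest_globalFidelity (by norm_num) (by norm_num) (by norm_num) hφ
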